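/- Let $H\in(1/2,1)$ and let $h:[-1/2,1/2]\to\mathbb R$ be even, positive and continuous, and three times continuously differentiable on $(-1/2,1/2)$. For $x\in[-1/2,1/2]$, $x\neq 0$, let $$f_H(x)=h(x)\,|2\sin \pi x|^{-(2H-1)}$$ be the spectral density of the fractionally differenced process $(1-B)^{-(H-1/2)}Y$ whose driving process $Y$ is real-valued and second-order stationary with spectral density $h$ ($B$ is the backshift operator), and let $$f_H^*(x)=c_f^*\,\pi^{-2}(2\pi)^{2H+1}\sin^2(\pi x)\sum_{j=-\infty}^{\infty}|2\pi j+2\pi x|^{-(2H+1)},\qquad c_f^*=V(2\pi)^{2-2H}\,\pi^{-1}H\,\Gamma(2H)\sin(H\pi),$$ be the spectral density of fractional Gaussian noise with Hurst parameter $H$ and variance $V>0$. Suppose that $V$ is chosen such that both densities have the same power-law prefactor at the origin, i.e. $c_f^*=c_f:=(2\pi)^{1-2H}h(0)$. Then there is a function $\varphi$ with $f_H(x)=f_H^*(x)+\varphi(x)$ for all $x\in[-1/2,1/2]$, $x\ne0$, such that $\varphi(0)=0$, $\varphi(x)=O(|x|^{3-2H})$ as $x\to0$, and $\varphi$ is differentiable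 on $(-1/2,1/2)$ (in particular, $\varphi$ is the continuous extension of $f_H-f_H^*$ to the origin). For every $0\le\alpha<2-2H$ and $0<r<1/2$, the derivative $\varphi'$ is uniformly $\alpha$-Hölder continuous on $[-r,r]$, i.e. $\sup_{x\neq y}|\varphi'(x)-\varphi'(y)|\,|x-y|^{-\alpha}<\infty$ over $x,y\in[-r,r]$. If moreover $h$ is three times continuously differentiable up to the endpoints, i.e. on the closed interval $[-1/2,1/2]$, then $\varphi$ is differentiable on $[-1/2,1/2]$ (one-sidedly at the endpoints) and, for every $0\le\alpha<2-2H$, $\varphi'$ is uniformly $\alpha$-Hölder continuous on all of $[-1/2,1/2]$. -/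

import Mathlib

open Set Filter Topology Asymptotics
open scoped NNReal

noncomputable section

namespace FracNoise

/-- Spectral density, at normalised frequency `x ∈ [-1/2, 1/2]`, `x ≠ 0`, of the process
`(1 - B)^{-(H - 1/2)} Y`, where `h` is the spectral density of the driving process `Y`:
`f_H(x) = h(x) |2 sin πx|^{-(2H-1)}`. -/
def fracDensity (H : ℝ) (h : ℝ → ℝ) (x : ℝ) : ℝ :=
  h x * |2 * Real.sin (Real.pi * x)| ^ (-(2 * H - 1))

/-- Prefactor `c_f = (2π)^{1-2H} h(0)` of the power law of `f_H` at the origin. -/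
def fracPrefactor (H : ℝ) (h : ℝ → ℝ) : ℝ :=
  (2 * Real.pi) ^ (1 - 2 * H) * h 0

/-- The constant `C(H) = π⁻¹ H Γ(2H) sin(Hπ)`. -/
def fgnConst (H : ℝ) : ℝ :=
  Real.pi⁻¹ * H * Real.Gamma (2 * H) * Real.sin (H * Real.pi)

/-- Prefactor `c_f^* = V (2π)^{2-2H} C(H)` of the power law at the origin of the spectral density
of fractional Gaussian noise with Hurst parameter `H` and variance `V`. -/
def fgnPrefactor (H V : ℝ) : ℝ :=
  V * (2 * Real.pi) ^ (2 - 2 * H) * fgnConst H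

/-- Spectral density, at normalised frequency `x ∈ [-1/2, 1/2]`, `x ≠ 0`, of fractional Gaussian
noise with Hurst parameter `H` and variance `V`:
`f_H^*(x) = c_f^* π⁻² (2π)^{2H+1} sin²(πx) ∑_{j ∈ ℤ} |2πj + 2πx|^{-(2H+1)}`. -/
def fgnDensity (H V x : ℝ) : ℝ :=
  fgnPrefactor H V * (Real.pi ^ 2)⁻¹ * (2 * Real.pi) ^ (2 * H + 1) *
    Real.sin (Real.pi * x) ^ 2 *
    ∑' j : ℤ, |2 * Real.pi * (j : ℝ) + 2 * Real.pi * x| ^ (-(2 * H + 1))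

end FracNoise

end

/-!
Put `α = 2 - 2H` and `s(x) = sin(πx) / (πx)`. The term `j = 0` of `f_H^*` is `c_f s(x)² |x|^{α-1}`,
and `f_H(x) = (2π)^{α-1} h(x) s(x)^{α-1} |x|^{α-1}`. As the prefactors agree, the difference of
these two is `|x|^{α-1} g(x)` with `g` of class `C²` and `g(0) = g'(0) = 0`, the latter because `h`
and `s` are even. Its derivative is `|x|^{α-1} m(x)` with `m(x) = g'(x) + (α - 1) g(x) / x`
Lipschitz and `m(0) = 0`, and every function of this form is `α`-Hölder. The terms `j ≠ 0` of
`f_H^*` add up to an even function that is smooth on `(-1, 1)` and vanishes at `0`.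
-/

namespace FracNoise

section PowerWeights

theorem mul_rpow_sub_one {a α : ℝ} (ha : 0 ≤ a) (hα : α ≠ 0) : a * a ^ (α - 1) = a ^ α := by
  rw [← Real.rpow_one_add' ha (by simpa using hα), add_sub_cancel]

theorem mul_abs_rpow_sub_rpow_le {a b α : ℝ} (hb : 0 ≤ b) (hba : b ≤ a) (hα0 : 0 < α)
    (hα1 : α ≤ 1) : b * |a ^ (α - 1) - b ^ (α - 1)| ≤ (a - b) * a ^ (α - 1) := by
  rcases hb.eq_or_lt with rfl | hb'
  · simp only [zero_mul, sub_zero]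
    positivity
  have hanti : a ^ (α - 1) ≤ b ^ (α - 1) :=
    Real.rpow_le_rpow_of_nonpos hb' hba (sub_nonpos.2 hα1)
  have hmono : b ^ α ≤ a ^ α := Real.rpow_le_rpow hb hba hα0.le
  rw [← mul_rpow_sub_one hb hα0.ne', ← mul_rpow_sub_one (hb.trans hba) hα0.ne'] at hmono
  rw [abs_sub_comm, abs_of_nonneg (sub_nonneg.2 hanti)]
  linarith

theorem mul_rpow_sub_one_le_two_mul_rpow {a δ α : ℝ} (hδ : 0 ≤ δ) (hδa : δ ≤ 2 * a) (hα0 : 0 < α)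
    (hα1 : α ≤ 1) : δ * a ^ (α - 1) ≤ 2 * δ ^ α := by
  rcases hδ.eq_or_lt with rfl | hδ'
  · simp [Real.zero_rpow hα0.ne']
  calc δ * a ^ (α - 1) ≤ δ * (δ / 2) ^ (α - 1) := by
        gcongr ?_ * ?_
        exact Real.rpow_le_rpow_of_nonpos (by positivity) (by linarith) (by linarith)
    _ = 2 * (δ / 2 * (δ / 2) ^ (α - 1)) := by ring
    _ = 2 * (δ / 2) ^ α := by rw [mul_rpow_sub_one (by positivity) hα0.ne']
    _ ≤ 2 * δ ^ α := by gcongr; linarith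

theorem holderOnWith_of_dist_le {X Y : Type*} [PseudoMetricSpace X] [PseudoMetricSpace Y]
    {C α : ℝ≥0} {f : X → Y} {S : Set X}
    (hf : ∀ x ∈ S, ∀ y ∈ S, dist (f x) (f y) ≤ C * dist x y ^ (α : ℝ)) :
    HolderOnWith C α f S := by
  intro x hx y hy
  rw [edist_dist, edist_dist, ENNReal.ofReal_rpow_of_nonneg dist_nonneg α.coe_nonneg,
    ← ENNReal.ofReal_coe_nnreal, ← ENNReal.ofReal_mul C.coe_nonneg]
  exact ENNReal.ofReal_le_ofReal (hf x hx y hy)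

variable {E F : Type*} [SeminormedAddCommGroup E] [SeminormedAddCommGroup F] [NormedSpace ℝ F]

theorem holderOnWith_norm_rpow_sub_one_smul {α K : ℝ≥0} {m : E → F} {S : Set E} (hα0 : 0 < α)
    (hα1 : α ≤ 1) (hm : LipschitzOnWith K m S) (h0 : (0 : E) ∈ S) (hm0 : m 0 = 0) :
    HolderOnWith (4 * K) α (fun x ↦ ‖x‖ ^ (α - 1 : ℝ) • m x) S := by
  refine holderOnWith_of_dist_le fun x hx y hy ↦ ?_
  wlog hyx : ‖y‖ ≤ ‖x‖ generalizing x y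
  · rw [dist_comm, dist_comm x]
    exact this y hy x hx (le_of_not_ge hyx)
  have hmy : ‖m y‖ ≤ K * ‖y‖ := by simpa [hm0] using hm.norm_sub_le hy h0
  have hweight : |‖x‖ ^ (α - 1 : ℝ) - ‖y‖ ^ (α - 1 : ℝ)| * ‖m y‖ ≤
      K * (‖x - y‖ * ‖x‖ ^ (α - 1 : ℝ)) := by
    grw [hmy, mul_left_comm, mul_comm |_|, mul_abs_rpow_sub_rpow_le (norm_nonneg y) hyx
      (mod_cast hα0) (mod_cast hα1), norm_sub_norm_le]
  rw [dist_eq_norm, dist_eq_norm]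
  calc ‖‖x‖ ^ (α - 1 : ℝ) • m x - ‖y‖ ^ (α - 1 : ℝ) • m y‖
      = ‖‖x‖ ^ (α - 1 : ℝ) • (m x - m y) + (‖x‖ ^ (α - 1 : ℝ) - ‖y‖ ^ (α - 1 : ℝ)) • m y‖ := by
        congr 1
        module
    _ ≤ ‖x‖ ^ (α - 1 : ℝ) * ‖m x - m y‖ + |‖x‖ ^ (α - 1 : ℝ) - ‖y‖ ^ (α - 1 : ℝ)| * ‖m y‖ := by
        refine (norm_add_le _ _).trans_eq ?_
        rw [norm_smul, norm_smul, Real.norm_eq_abs, Real.norm_eq_abs,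
          abs_of_nonneg (Real.rpow_nonneg (norm_nonneg x) _)]
    _ ≤ ‖x‖ ^ (α - 1 : ℝ) * (K * ‖x - y‖) + K * (‖x - y‖ * ‖x‖ ^ (α - 1 : ℝ)) := by
        grw [hm.norm_sub_le hx hy, hweight]
    _ = 2 * K * (‖x - y‖ * ‖x‖ ^ (α - 1 : ℝ)) := by ring
    _ ≤ 2 * K * (2 * ‖x - y‖ ^ (α : ℝ)) := by
        grw [mul_rpow_sub_one_le_two_mul_rpow (norm_nonneg _)
          ((norm_sub_le x y).trans (by linarith)) (mod_cast hα0) (mod_cast hα1)]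
    _ = (4 * K : ℝ≥0) * ‖x - y‖ ^ (α : ℝ) := by push_cast; ring

end PowerWeights

section HolderDerivative

variable {F : Type*} [NormedAddCommGroup F] [NormedSpace ℝ F] {f g : ℝ → F} {S T : Set ℝ}
  {α β : ℝ≥0}

/-- Functions of class `C^{1,α}` on `S`, uniformly: `f` is differentiable on `S` and its derivative
there is `α`-Hölder. The derivative is taken within `S`, hence one-sided at the endpoints of an
interval. -/
def HasHolderDerivOn (α : ℝ≥0) (f : ℝ → F) (S : Set ℝ) : Prop :=
  DifferentiableOn ℝ f S ∧ ∃ C : ℝ≥0, HolderOnWith C α (derivWithin f S) S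

theorem HasHolderDerivOn.of_hasDerivWithinAt {f' : ℝ → F} {C : ℝ≥0} (hS : UniqueDiffOn ℝ S)
    (hf : ∀ x ∈ S, HasDerivWithinAt f (f' x) S x) (hf' : HolderOnWith C α f' S) :
    HasHolderDerivOn α f S := by
  refine ⟨fun x hx ↦ (hf x hx).differentiableWithinAt, C, fun x hx y hy ↦ ?_⟩
  rw [(hf x hx).derivWithin (hS x hx), (hf y hy).derivWithin (hS y hy)]
  exact hf' x hx y hy

theorem uniqueDiffOn_of_convex_of_mem_nhds {E : Type*} [NormedAddCommGroup E] [NormedSpace ℝ E]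
    {S : Set E} {x : E} (hS : Convex ℝ S) (hx : S ∈ 𝓝 x) : UniqueDiffOn ℝ S :=
  uniqueDiffOn_convex hS ⟨x, mem_interior_iff_mem_nhds.2 hx⟩

theorem hasHolderDerivOn_one_of_contDiffOn (hS : UniqueDiffOn ℝ S) (hconv : Convex ℝ S)
    (hcomp : IsCompact S) (hf : ContDiffOn ℝ 2 f S) : HasHolderDerivOn 1 f S := by
  have hf' : ContDiffOn ℝ 1 (derivWithin f S) S := hf.derivWithin hS (by norm_num)
  obtain ⟨K, hK⟩ := (hf'.locallyLipschitzOn hconv).exists_lipschitzOnWith_of_compact hcomp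
  exact ⟨hf.differentiableOn (by norm_num), K, holderOnWith_one.2 hK⟩

theorem HasHolderDerivOn.mono_exponent (hf : HasHolderDerivOn β f S)
    (hS : Bornology.IsBounded S) (hαβ : α ≤ β) : HasHolderDerivOn α f S := by
  obtain ⟨hdiff, C, hC⟩ := hf
  refine ⟨hdiff, _, hC.of_le (D := (Metric.ediam S).toNNReal) (fun x hx y hy ↦ ?_) hαβ⟩
  rw [ENNReal.coe_toNNReal hS.ediam_ne_top]
  exact Metric.edist_le_ediam_of_mem hx hy

theorem HasHolderDerivOn.sub (hf : HasHolderDerivOn α f S) (hg : HasHolderDerivOn α g S)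
    (hS : UniqueDiffOn ℝ S) : HasHolderDerivOn α (f - g) S := by
  obtain ⟨hf, C, hC⟩ := hf
  obtain ⟨hg, D, hD⟩ := hg
  refine .of_hasDerivWithinAt (C := C + D) hS
    (fun x hx ↦ (hf x hx).hasDerivWithinAt.sub (hg x hx).hasDerivWithinAt)
    (holderOnWith_of_dist_le fun x hx y hy ↦ ?_)
  grw [dist_sub_sub_le, hC.dist_le hx hy, hD.dist_le hx hy, NNReal.coe_add, add_mul]

theorem HasHolderDerivOn.differentiableAt (hf : HasHolderDerivOn α f S) {x : ℝ}
    (hx : x ∈ interior S) : DifferentiableAt ℝ f x :=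
  hf.1.differentiableAt (mem_interior_iff_mem_nhds.1 hx)

theorem HasHolderDerivOn.exists_holderOnWith_deriv (hf : HasHolderDerivOn α f S)
    (hT : T ⊆ interior S) : ∃ C : ℝ≥0, HolderOnWith C α (deriv f) T := by
  obtain ⟨-, C, hC⟩ := hf
  refine ⟨C, fun x hx y hy ↦ ?_⟩
  rw [← derivWithin_of_mem_nhds (mem_interior_iff_mem_nhds.1 (hT hx)),
    ← derivWithin_of_mem_nhds (mem_interior_iff_mem_nhds.1 (hT hy))]
  exact hC x (interior_subset (hT hx)) y (interior_subset (hT hy))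

theorem HasHolderDerivOn.isBigO_abs_rpow (hf : HasHolderDerivOn α f S) (hS : StarConvex ℝ 0 S)
    (h0 : f 0 = 0) (h0' : derivWithin f S 0 = 0) :
    f =O[𝓝[S] 0] fun x ↦ |x| ^ (1 + α : ℝ) := by
  obtain ⟨hdiff, C, hC⟩ := hf
  refine IsBigO.of_bound C (eventually_mem_nhdsWithin.mono fun x hx ↦ ?_)
  have hsub : segment ℝ 0 x ⊆ S := hS.segment_subset hx
  have hbound : ∀ t ∈ segment ℝ 0 x, ‖derivWithin f S t‖ ≤ C * |x| ^ (α : ℝ) := fun t ht ↦ by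
    have htx : |t| ≤ |x| := by
      rw [segment_eq_uIcc] at ht
      simpa only [sub_zero] using abs_sub_left_of_mem_uIcc ht
    simpa [h0'] using hC.dist_le_of_le (hsub ht) (hsub (left_mem_segment ℝ 0 x))
      (d := |x|) (by simpa using htx)
  have hmean := (convex_segment (0 : ℝ) x).norm_image_sub_le_of_norm_hasDerivWithin_le
    (fun t ht ↦ (hdiff t (hsub ht)).hasDerivWithinAt.mono hsub) hbound
    (left_mem_segment ℝ 0 x) (right_mem_segment ℝ 0 x)
  rw [h0, sub_zero, sub_zero, Real.norm_eq_abs] at hmean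
  rw [Real.norm_of_nonneg (by positivity), Real.rpow_one_add' (abs_nonneg x) (by positivity)]
  linarith

-- Apply the mean value inequality on `[0, 1]` to `t ↦ x⁻¹ • g (t * x) - y⁻¹ • g (t * y)`, whose
-- derivative `g' (t * x) - g' (t * y)` is at most `K * |x - y|`.
theorem lipschitzOnWith_inv_smul {g' : ℝ → F} {K : ℝ≥0} (hS : StarConvex ℝ 0 S)
    (hg : ∀ x ∈ S, HasDerivWithinAt g (g' x) S x) (hg' : LipschitzOnWith K g' S) (h0 : g 0 = 0)
    (h0' : g' 0 = 0) : LipschitzOnWith K (fun x ↦ x⁻¹ • g x) S := by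
  have hmem : ∀ x ∈ S, MapsTo (· * x) (Icc (0 : ℝ) 1) S := fun x hx t ht ↦
    hS.smul_mem hx ht.1 ht.2
  have hderiv : ∀ x ∈ S, ∀ t ∈ Icc (0 : ℝ) 1,
      HasDerivWithinAt (fun t ↦ x⁻¹ • g (t * x)) (g' (t * x)) (Icc 0 1) t := fun x hx t ht ↦ by
    rcases eq_or_ne x 0 with rfl | hx0
    · simpa [h0'] using hasDerivWithinAt_const t (Icc (0 : ℝ) 1) (0 : F)
    · simpa [hx0, Function.comp_def] using! ((hg _ (hmem x hx ht)).scomp t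
        ((hasDerivWithinAt_id t _).mul_const x) (hmem x hx)).const_smul x⁻¹
  refine LipschitzOnWith.of_dist_le_mul fun x hx y hy ↦ ?_
  have hmean := norm_image_sub_le_of_norm_deriv_le_segment_01' (C := K * dist x y)
    (fun t ht ↦ (hderiv x hx t ht).sub (hderiv y hy t ht)) fun t ht ↦ by
      have ht' := Ico_subset_Icc_self ht
      grw [hg'.norm_sub_le (hmem x hx ht') (hmem y hy ht'), ← mul_sub, norm_mul,
        Real.norm_of_nonneg ht.1, ht.2.le, one_mul, dist_eq_norm]
  simpa [h0, dist_eq_norm] using hmean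

theorem isBigO_abs_rpow_smul {p q : ℝ} (hpq : p + q ≠ 0)
    (hg : g =O[𝓝[S] 0] fun x ↦ |x| ^ q) :
    (fun x ↦ |x| ^ p • g x) =O[𝓝[S] 0] fun x ↦ |x| ^ (p + q) := by
  simpa only [smul_eq_mul, ← Real.rpow_add' (abs_nonneg _) hpq] using
    (isBigO_refl (fun x : ℝ ↦ |x| ^ p) (𝓝[S] 0)).smul hg

theorem hasDerivWithinAt_zero_of_isBigO_abs_rpow {p : ℝ} (hp : 1 < p) (h0 : f 0 = 0)
    (hf : f =O[𝓝[S] 0] fun x ↦ |x| ^ p) : HasDerivWithinAt f 0 S 0 := by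
  have hpow := (hasDerivAt_abs_rpow 0 hp).hasDerivWithinAt (s := S)
  rw [hasDerivWithinAt_iff_isLittleO] at hpow ⊢
  simp only [abs_zero, Real.zero_rpow (by linarith : p ≠ 0), mul_zero, smul_zero, sub_zero,
    h0] at hpow ⊢
  exact hf.trans_isLittleO hpow

theorem hasDerivWithinAt_abs_rpow_smul {p x : ℝ} {g' : F} (hx : x ≠ 0)
    (hg : HasDerivWithinAt g g' S x) :
    HasDerivWithinAt (fun x ↦ |x| ^ p • g x) (|x| ^ p • (g' + p • x⁻¹ • g x)) S x := by
  have hpow : HasDerivAt (fun x : ℝ ↦ |x| ^ p) (|x| ^ p * (p * x⁻¹)) x := by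
    refine ((hasDerivAt_abs hx).rpow_const (Or.inl (abs_pos.2 hx).ne')).congr_deriv ?_
    rw [Real.rpow_sub_one (abs_pos.2 hx).ne']
    rcases hx.lt_or_gt with hneg | hpos
    · rw [sign_neg hneg, abs_of_neg hneg, SignType.coe_neg_one]
      field_simp
    · rw [sign_pos hpos, abs_of_pos hpos, SignType.coe_one]
      field_simp
  refine (hpow.hasDerivWithinAt.smul hg).congr_deriv ?_
  module

theorem HasHolderDerivOn.abs_rpow_sub_one_smul (hα0 : 0 < α) (hα1 : α ≤ 1)
    (hg : HasHolderDerivOn 1 g S) (hS : StarConvex ℝ 0 S) (hS' : UniqueDiffOn ℝ S)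
    (hmem : (0 : ℝ) ∈ S) (h0 : g 0 = 0) (h0' : derivWithin g S 0 = 0) :
    HasHolderDerivOn α (fun x ↦ |x| ^ (α - 1 : ℝ) • g x) S := by
  have hexp : (1 : ℝ) < α - 1 + (1 + (1 : ℝ≥0)) := by
    push_cast
    linarith [NNReal.coe_pos.2 hα0]
  have hzero : HasDerivWithinAt (fun x ↦ |x| ^ (α - 1 : ℝ) • g x) 0 S 0 :=
    hasDerivWithinAt_zero_of_isBigO_abs_rpow hexp (by simp only [h0, smul_zero]) <|
      isBigO_abs_rpow_smul (zero_lt_one.trans hexp).ne' (hg.isBigO_abs_rpow hS h0 h0')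
  obtain ⟨hdiff, K, hK⟩ := hg
  have hderiv := fun x hx ↦ (hdiff x hx).hasDerivWithinAt
  have hlip : LipschitzOnWith (K + ‖(α - 1 : ℝ)‖₊ * K)
      (fun x ↦ derivWithin g S x + (α - 1 : ℝ) • x⁻¹ • g x) S :=
    (holderOnWith_one.1 hK).add <| (lipschitzWith_smul (α - 1 : ℝ)).comp_lipschitzOnWith <|
      lipschitzOnWith_inv_smul hS hderiv (holderOnWith_one.1 hK) h0 h0'
  refine .of_hasDerivWithinAt hS' (fun x hx ↦ ?_)
    (holderOnWith_norm_rpow_sub_one_smul hα0 hα1 hlip hmem (by simp [h0, h0']))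
  rcases eq_or_ne x 0 with rfl | hx0
  · simpa [h0, h0'] using hzero
  · exact hasDerivWithinAt_abs_rpow_smul hx0 (hderiv x hx)

theorem deriv_zero_of_eventually_even (hf : ∀ᶠ x in 𝓝 0, f (-x) = f x) : deriv f 0 = 0 := by
  have hneg : -deriv f 0 = deriv f 0 := by
    simpa only [deriv_comp_neg, neg_zero] using EventuallyEq.deriv_eq (f₁ := fun x ↦ f (-x)) hf
  have : IsAddTorsionFree F := .of_isTorsionFree ℝ F
  exact self_eq_neg.1 hneg.symm

end HolderDerivative

section Sinc

theorem contDiff_sinc {n : WithTop ℕ∞} : ContDiff ℝ n Real.sinc := by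
  suffices AnalyticOnNhd ℝ (dslope Real.sin 0) univ from
    Real.sinc_eq_dslope ▸ this.contDiff
  intro x _
  rcases eq_or_ne x 0 with rfl | hx
  · obtain ⟨p, hp⟩ := Real.analyticAt_sin (x := 0)
    exact ⟨_, hp.has_fpower_series_dslope_fslope⟩
  · have hdiv : AnalyticAt ℝ (fun y ↦ Real.sin y / y) x := Real.analyticAt_sin.div analyticAt_id hx
    refine hdiv.congr ?_
    filter_upwards [isOpen_ne.mem_nhds hx] with y hy
    rw [← Real.sinc_eq_dslope, Real.sinc_of_ne_zero hy]

theorem mul_sinc (x : ℝ) : x * Real.sinc x = Real.sin x := by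
  rcases eq_or_ne x 0 with rfl | hx
  · simp
  · rw [Real.sinc_of_ne_zero hx, mul_div_cancel₀ _ hx]

theorem sinc_pi_mul_pos {x : ℝ} (hx : x ∈ Ioo (-1 : ℝ) 1) : 0 < Real.sinc (Real.pi * x) := by
  wlog h0 : 0 ≤ x generalizing x
  · simpa using this (x := -x) ⟨by linarith [hx.2], by linarith [hx.1]⟩ (by linarith)
  rcases h0.eq_or_lt with rfl | hpos
  · simp
  have hpx : 0 < Real.pi * x := by positivity
  rw [Real.sinc_of_ne_zero hpx.ne']
  exact div_pos (Real.sin_pos_of_pos_of_lt_pi hpx (by nlinarith [Real.pi_pos, hx.2])) hpx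

theorem hasDerivAt_sinc_pi_mul_zero : HasDerivAt (fun x ↦ Real.sinc (Real.pi * x)) 0 0 := by
  have hdiff : Differentiable ℝ fun x ↦ Real.sinc (Real.pi * x) :=
    (contDiff_sinc (n := 1)).differentiable_one.comp (differentiable_id.const_mul Real.pi)
  simpa only [deriv_zero_of_eventually_even (f := fun x ↦ Real.sinc (Real.pi * x))
    (.of_forall fun x ↦ by rw [mul_neg, Real.sinc_neg])] using (hdiff 0).hasDerivAt

end Sinc

section HurwitzSeries

/-- The Hurwitz zeta function `ζ(p, a) = ∑_{n ≥ 0} (n + a)^{-p}`, as a function of the real shift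
`a > 0` for real `p > 1`. -/
noncomputable def hurwitzSeries (p a : ℝ) : ℝ := ∑' n : ℕ, ((n : ℝ) + a) ^ (-p)

theorem hasSum_hurwitzSeries {p a : ℝ} (hp : 1 < p) (ha : 0 < a) :
    HasSum (fun n : ℕ ↦ ((n : ℝ) + a) ^ (-p)) (hurwitzSeries p a) := by
  refine (((Real.summable_one_div_nat_add_rpow a p).2 hp).congr fun n ↦ ?_).hasSum
  rw [abs_of_pos (by positivity), Real.rpow_neg (by positivity), one_div]

theorem differentiableOn_tsum_nat_add_cpow_neg {p ε : ℝ} (hp : 1 < p) (hε : 0 < ε) :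
    DifferentiableOn ℂ (fun z : ℂ ↦ ∑' n : ℕ, ((n : ℂ) + z) ^ ((-p : ℝ) : ℂ)) {z | ε < z.re} := by
  have hre : ∀ (n : ℕ) (z : ℂ), ε < z.re → (n : ℝ) + ε < ((n : ℂ) + z).re := fun n z hz ↦ by
    simpa using hz
  refine Complex.differentiableOn_tsum_of_summable_norm (hasSum_hurwitzSeries hp hε).summable
    (fun n z hz ↦ ?_) (isOpen_lt continuous_const Complex.continuous_re) fun n z hz ↦ ?_
  · have hslit : (n : ℂ) + z ∈ Complex.slitPlane :=
      Or.inl ((add_pos_of_nonneg_of_pos n.cast_nonneg hε).trans (hre n z hz))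
    exact ((differentiableAt_id.const_add (n : ℂ)).cpow_const hslit).differentiableWithinAt
  · rw [Complex.norm_cpow_real]
    exact Real.rpow_le_rpow_of_nonpos (by positivity)
      ((hre n z hz).le.trans (Complex.re_le_norm _)) (by linarith)

theorem contDiffAt_hurwitzSeries {n : WithTop ℕ∞} {p a : ℝ} (hp : 1 < p) (ha : 0 < a) :
    ContDiffAt ℝ n (hurwitzSeries p) a := by
  have hanalytic := (differentiableOn_tsum_nat_add_cpow_neg hp (half_pos ha)).analyticOnNhd
    (isOpen_lt continuous_const Complex.continuous_re) (a : ℂ) (half_lt_self ha)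
  refine (hanalytic.contDiffAt (n := n)).real_of_complex.congr_of_eventuallyEq ?_
  filter_upwards [lt_mem_nhds ha] with b hb
  have hterm : ∀ k : ℕ, ((k : ℂ) + b) ^ ((-p : ℝ) : ℂ) = (((k : ℝ) + b) ^ (-p) : ℝ) := fun k ↦ by
    rw [Complex.ofReal_cpow (by positivity), Complex.ofReal_add, Complex.ofReal_natCast]
  simp_rw [hterm, ← Complex.ofReal_tsum, Complex.ofReal_re, hurwitzSeries]

theorem hasSum_abs_int_add_rpow_neg {p x : ℝ} (hp : 1 < p) (hx : x ∈ Ioo (-1 : ℝ) 1) :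
    HasSum (fun j : ℤ ↦ |j + x| ^ (-p))
      (|x| ^ (-p) + (hurwitzSeries p (1 + x) + hurwitzSeries p (1 - x))) := by
  have hpos : HasSum (fun n : ℕ ↦ |((n + 1 : ℤ) : ℝ) + x| ^ (-p)) (hurwitzSeries p (1 + x)) := by
    convert hasSum_hurwitzSeries hp (by linarith [hx.1] : 0 < 1 + x) using 3 with n
    push_cast
    rw [abs_of_pos (by linarith [hx.1, (n.cast_nonneg : (0 : ℝ) ≤ n)]), add_assoc]
  have hneg : HasSum (fun n : ℕ ↦ |((-(n + 1 : ℤ) : ℤ) : ℝ) + x| ^ (-p))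
      (hurwitzSeries p (1 - x)) := by
    convert hasSum_hurwitzSeries hp (by linarith [hx.2] : 0 < 1 - x) using 3 with n
    push_cast
    rw [abs_of_neg (by linarith [hx.2, (n.cast_nonneg : (0 : ℝ) ≤ n)])]
    ring
  convert HasSum.of_add_one_of_neg_add_one (f := fun j : ℤ ↦ |(j : ℝ) + x| ^ (-p)) hpos hneg using 1
  simp only [Int.cast_zero, zero_add]
  ring

end HurwitzSeries

section SpectralDensities

/-- The function `g` for which `|x|^{1-2H} g(x)` is `f_H(x)` minus the term `j = 0` of `f_H^*(x)`,
when both densities have the prefactor `c_f` at the origin. -/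
noncomputable def regularFactor (H : ℝ) (h : ℝ → ℝ) (x : ℝ) : ℝ :=
  (2 * Real.pi) ^ (1 - 2 * H) *
    (h x * Real.sinc (Real.pi * x) ^ (1 - 2 * H) - h 0 * Real.sinc (Real.pi * x) ^ 2)

/-- The terms `j ≠ 0` of the spectral density of fractional Gaussian noise with prefactor `c`. -/
noncomputable def aliasedPart (H c x : ℝ) : ℝ :=
  c * (Real.pi ^ 2)⁻¹ * Real.sin (Real.pi * x) ^ 2 *
    (hurwitzSeries (2 * H + 1) (1 + x) + hurwitzSeries (2 * H + 1) (1 - x))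

/-- The continuous extension `φ` of `f_H - f_H^*` to the origin. -/
noncomputable def densityDiff (H : ℝ) (h : ℝ → ℝ) (x : ℝ) : ℝ :=
  |x| ^ (1 - 2 * H) * regularFactor H h x - aliasedPart H (fracPrefactor H h) x

variable {H : ℝ} {h : ℝ → ℝ} {S : Set ℝ}

theorem fracDensity_eq_abs_rpow_mul {x : ℝ} (hx : x ∈ Ioo (-1 : ℝ) 1) :
    fracDensity H h x = |x| ^ (1 - 2 * H) *
      ((2 * Real.pi) ^ (1 - 2 * H) * (h x * Real.sinc (Real.pi * x) ^ (1 - 2 * H))) := by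
  have hsinc := sinc_pi_mul_pos hx
  have habs : |2 * Real.sin (Real.pi * x)| = 2 * Real.pi * |x| * Real.sinc (Real.pi * x) := by
    rw [← mul_sinc, abs_mul, abs_mul, abs_mul, abs_of_pos hsinc, abs_of_pos Real.pi_pos, abs_two]
    ring
  rw [fracDensity, habs, neg_sub, Real.mul_rpow (by positivity) hsinc.le,
    Real.mul_rpow (by positivity) (abs_nonneg x)]
  ring

theorem fgnDensity_eq_tsum_abs_int_add (H V x : ℝ) :
    fgnDensity H V x = fgnPrefactor H V * (Real.pi ^ 2)⁻¹ * Real.sin (Real.pi * x) ^ 2 *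
      ∑' j : ℤ, |j + x| ^ (-(2 * H + 1)) := by
  have hpi : 0 < 2 * Real.pi := by positivity
  have hterm : ∀ j : ℤ, |2 * Real.pi * j + 2 * Real.pi * x| ^ (-(2 * H + 1)) =
      (2 * Real.pi) ^ (-(2 * H + 1)) * |j + x| ^ (-(2 * H + 1)) := fun j ↦ by
    rw [← mul_add, abs_mul, abs_of_pos hpi, Real.mul_rpow hpi.le (abs_nonneg _)]
  have hcancel : (2 * Real.pi) ^ (2 * H + 1) * (2 * Real.pi) ^ (-(2 * H + 1)) = 1 := by
    rw [← Real.rpow_add hpi, add_neg_cancel, Real.rpow_zero]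
  simp_rw [fgnDensity, hterm, tsum_mul_left]
  linear_combination fgnPrefactor H V * (Real.pi ^ 2)⁻¹ * Real.sin (Real.pi * x) ^ 2 *
    (∑' j : ℤ, |j + x| ^ (-(2 * H + 1))) * hcancel

theorem sin_pi_mul_sq_mul_abs_rpow {x : ℝ} (hx : x ≠ 0) :
    Real.sin (Real.pi * x) ^ 2 * |x| ^ (-(2 * H + 1)) =
      Real.pi ^ 2 * (|x| ^ (1 - 2 * H) * Real.sinc (Real.pi * x) ^ 2) := by
  have hpow : |x| ^ (1 - 2 * H) = x ^ 2 * |x| ^ (-(2 * H + 1)) := by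
    rw [← sq_abs, ← Real.rpow_natCast, ← Real.rpow_add (abs_pos.2 hx)]
    congr 1
    push_cast
    ring
  rw [← mul_sinc, hpow]
  ring

theorem fgnDensity_eq_add_aliasedPart {V x : ℝ} (hH : 0 < H) (hx : x ∈ Ioo (-1 : ℝ) 1)
    (hx0 : x ≠ 0) :
    fgnDensity H V x = |x| ^ (1 - 2 * H) * (fgnPrefactor H V * Real.sinc (Real.pi * x) ^ 2) +
      aliasedPart H (fgnPrefactor H V) x := by
  have hpi : (Real.pi ^ 2)⁻¹ * Real.pi ^ 2 = 1 := inv_mul_cancel₀ (by positivity)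
  rw [fgnDensity_eq_tsum_abs_int_add, (hasSum_abs_int_add_rpow_neg (by linarith) hx).tsum_eq,
    aliasedPart]
  linear_combination fgnPrefactor H V * (Real.pi ^ 2)⁻¹ * sin_pi_mul_sq_mul_abs_rpow (H := H) hx0 +
    fgnPrefactor H V * |x| ^ (1 - 2 * H) * Real.sinc (Real.pi * x) ^ 2 * hpi

theorem fracDensity_eq_fgnDensity_add_densityDiff {V x : ℝ} (hH : 0 < H)
    (hnorm : fracPrefactor H h = fgnPrefactor H V) (hx : x ∈ Ioo (-1 : ℝ) 1) (hx0 : x ≠ 0) :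
    fracDensity H h x = fgnDensity H V x + densityDiff H h x := by
  rw [fracDensity_eq_abs_rpow_mul hx, fgnDensity_eq_add_aliasedPart hH hx hx0, densityDiff, ← hnorm,
    regularFactor, fracPrefactor]
  ring

theorem regularFactor_zero (H : ℝ) (h : ℝ → ℝ) : regularFactor H h 0 = 0 := by
  simp [regularFactor]

theorem hasDerivAt_regularFactor_zero (hh : HasDerivAt h 0 0) :
    HasDerivAt (regularFactor H h) 0 0 := by
  have hrpow := hasDerivAt_sinc_pi_mul_zero.rpow_const (p := 1 - 2 * H) (.inl (by simp))
  have hsq := (hasDerivAt_sinc_pi_mul_zero.pow 2).const_mul (h 0)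
  simpa [regularFactor] using!
    ((hh.mul hrpow).sub hsq).const_mul ((2 * Real.pi) ^ (1 - 2 * H))

theorem contDiffOn_regularFactor {n : WithTop ℕ∞} (hS : S ⊆ Ioo (-1) 1) (hh : ContDiffOn ℝ n h S) :
    ContDiffOn ℝ n (regularFactor H h) S := by
  have hsinc : ContDiffOn ℝ n (fun x ↦ Real.sinc (Real.pi * x)) S :=
    (contDiff_sinc.comp (contDiff_const.mul contDiff_id)).contDiffOn
  have hrpow := hsinc.rpow_const_of_ne (p := 1 - 2 * H) fun x hx ↦ (sinc_pi_mul_pos (hS hx)).ne'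
  exact contDiffOn_const.mul ((hh.mul hrpow).sub (contDiffOn_const.mul (hsinc.pow 2)))

theorem aliasedPart_zero (H c : ℝ) : aliasedPart H c 0 = 0 := by
  simp [aliasedPart]

theorem aliasedPart_neg (H c x : ℝ) : aliasedPart H c (-x) = aliasedPart H c x := by
  simp only [aliasedPart, mul_neg, Real.sin_neg, neg_sq, sub_neg_eq_add, ← sub_eq_add_neg]
  rw [add_comm (hurwitzSeries _ (1 - x))]

theorem contDiffOn_aliasedPart {n : WithTop ℕ∞} {c : ℝ} (hH : 0 < H) :
    ContDiffOn ℝ n (aliasedPart H c) (Ioo (-1) 1) := fun x hx ↦ by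
  have hright : ContDiffAt ℝ n (fun x ↦ hurwitzSeries (2 * H + 1) (1 + x)) x :=
    (contDiffAt_hurwitzSeries (by linarith) (by linarith [hx.1])).comp x (by fun_prop)
  have hleft : ContDiffAt ℝ n (fun x ↦ hurwitzSeries (2 * H + 1) (1 - x)) x :=
    (contDiffAt_hurwitzSeries (by linarith) (by linarith [hx.2])).comp x (by fun_prop)
  have hsin : ContDiffAt ℝ n (fun x ↦ c * (Real.pi ^ 2)⁻¹ * Real.sin (Real.pi * x) ^ 2) x := by
    fun_prop
  exact (hsin.mul (hright.add hleft)).contDiffWithinAt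

theorem densityDiff_zero (H : ℝ) (h : ℝ → ℝ) : densityDiff H h 0 = 0 := by
  simp [densityDiff, regularFactor_zero, aliasedPart_zero]

theorem hasHolderDerivOn_one_regularFactor (hS : Convex ℝ S) (hcomp : IsCompact S) (hS0 : S ∈ 𝓝 0)
    (hS1 : S ⊆ Ioo (-1) 1) (hh : ContDiffOn ℝ 2 h S) : HasHolderDerivOn 1 (regularFactor H h) S :=
  hasHolderDerivOn_one_of_contDiffOn (uniqueDiffOn_of_convex_of_mem_nhds hS hS0)
    hS hcomp (contDiffOn_regularFactor hS1 hh)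

theorem derivWithin_regularFactor_zero (hS0 : S ∈ 𝓝 0) (hh : ContDiffOn ℝ 2 h S)
    (hh' : deriv h 0 = 0) : derivWithin (regularFactor H h) S 0 = 0 := by
  have hderiv : HasDerivAt h 0 0 := by
    simpa only [hh'] using ((hh.contDiffAt hS0).differentiableAt (by norm_num)).hasDerivAt
  rw [derivWithin_of_mem_nhds hS0, (hasDerivAt_regularFactor_zero hderiv).deriv]

theorem hasHolderDerivOn_one_aliasedPart {c : ℝ} (hH : 0 < H) (hS : Convex ℝ S)
    (hcomp : IsCompact S) (hS0 : S ∈ 𝓝 0) (hS1 : S ⊆ Ioo (-1) 1) :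
    HasHolderDerivOn 1 (aliasedPart H c) S :=
  hasHolderDerivOn_one_of_contDiffOn (uniqueDiffOn_of_convex_of_mem_nhds hS hS0)
    hS hcomp ((contDiffOn_aliasedPart hH).mono hS1)

theorem derivWithin_aliasedPart_zero {c : ℝ} (hS0 : S ∈ 𝓝 0) :
    derivWithin (aliasedPart H c) S 0 = 0 := by
  rw [derivWithin_of_mem_nhds hS0,
    deriv_zero_of_eventually_even (.of_forall (aliasedPart_neg H c))]

theorem hasHolderDerivOn_densityDiff {α : ℝ≥0} (hH : 1 / 2 ≤ H) (hH1 : H < 1)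
    (hα : (α : ℝ) ≤ 2 - 2 * H) (hS : Convex ℝ S) (hcomp : IsCompact S) (hS0 : S ∈ 𝓝 0)
    (hS1 : S ⊆ Ioo (-1) 1) (hh : ContDiffOn ℝ 2 h S) (hh' : deriv h 0 = 0) :
    HasHolderDerivOn α (densityDiff H h) S := by
  lift 2 - 2 * H to ℝ≥0 using by linarith with β hβ
  have hβ0 : 0 < β := by rw [← NNReal.coe_pos]; linarith
  have hβ1 : β ≤ 1 := by rw [← NNReal.coe_le_one]; linarith
  have hunique : UniqueDiffOn ℝ S := uniqueDiffOn_of_convex_of_mem_nhds hS hS0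
  have h0 : (0 : ℝ) ∈ S := mem_of_mem_nhds hS0
  have hregular := (hasHolderDerivOn_one_regularFactor (H := H) hS hcomp hS0 hS1 hh)
    |>.abs_rpow_sub_one_smul hβ0 hβ1 (hS.starConvex h0) hunique h0 (regularFactor_zero H h)
      (derivWithin_regularFactor_zero hS0 hh hh')
  have haliased := (hasHolderDerivOn_one_aliasedPart (c := fracPrefactor H h) (by linarith : 0 < H)
    hS hcomp hS0 hS1).mono_exponent hcomp.isBounded hβ1
  rw [show (β - 1 : ℝ) = 1 - 2 * H by linarith] at hregular
  exact (hregular.sub haliased hunique).mono_exponent hcomp.isBounded (mod_cast hα)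

theorem isBigO_densityDiff (hH : 1 / 2 ≤ H) (hH1 : H < 1) (hS : Convex ℝ S) (hcomp : IsCompact S)
    (hS0 : S ∈ 𝓝 0) (hS1 : S ⊆ Ioo (-1) 1) (hh : ContDiffOn ℝ 2 h S) (hh' : deriv h 0 = 0) :
    densityDiff H h =O[𝓝 0] fun x ↦ |x| ^ (3 - 2 * H) := by
  lift 2 - 2 * H to ℝ≥0 using by linarith with β hβ
  have hβ1 : β ≤ 1 := by rw [← NNReal.coe_le_one]; linarith
  have hstar : StarConvex ℝ 0 S := hS.starConvex (mem_of_mem_nhds hS0)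
  have hexp : 1 - 2 * H + (1 + (1 : ℝ≥0)) = 3 - 2 * H := by
    push_cast
    ring
  have hregular : (fun x ↦ |x| ^ (1 - 2 * H) • regularFactor H h x) =O[𝓝[S] 0]
      fun x ↦ |x| ^ (1 - 2 * H + (1 + (1 : ℝ≥0))) :=
    isBigO_abs_rpow_smul (hexp.trans_ne (by linarith : 0 < 3 - 2 * H).ne') <|
      (hasHolderDerivOn_one_regularFactor hS hcomp hS0 hS1 hh).isBigO_abs_rpow hstar
        (regularFactor_zero H h) (derivWithin_regularFactor_zero hS0 hh hh')
  have haliased : aliasedPart H (fracPrefactor H h) =O[𝓝[S] 0] fun x ↦ |x| ^ (1 + β : ℝ) :=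
    ((hasHolderDerivOn_one_aliasedPart (by linarith) hS hcomp hS0 hS1).mono_exponent
      hcomp.isBounded hβ1).isBigO_abs_rpow hstar (aliasedPart_zero H _)
        (derivWithin_aliasedPart_zero hS0)
  rw [nhdsWithin_eq_nhds.2 hS0] at hregular haliased
  rw [hexp] at hregular
  rw [show 1 + (β : ℝ) = 3 - 2 * H by linarith] at haliased
  exact hregular.sub haliased

theorem hasHolderDerivOn_densityDiff_Icc {α : ℝ≥0} {r R : ℝ} (hH : 1 / 2 ≤ H) (hH1 : H < 1)
    (hα : (α : ℝ) ≤ 2 - 2 * H) (hr : 0 < r) (hrR : r < R) (hR : R ≤ 1)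
    (hh : ContDiffOn ℝ 2 h (Ioo (-R) R)) (hh' : deriv h 0 = 0) :
    HasHolderDerivOn α (densityDiff H h) (Icc (-r) r) :=
  hasHolderDerivOn_densityDiff hH hH1 hα (convex_Icc _ _) isCompact_Icc
    (Icc_mem_nhds (neg_lt_zero.2 hr) hr) (Icc_subset_Ioo (by linarith) (by linarith))
    (hh.mono (Icc_subset_Ioo (neg_lt_neg hrR) hrR)) hh'

theorem differentiableOn_densityDiff_Ioo {R : ℝ} (hH : 1 / 2 ≤ H) (hH1 : H < 1) (hR : R ≤ 1)
    (hh : ContDiffOn ℝ 2 h (Ioo (-R) R)) (hh' : deriv h 0 = 0) :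
    DifferentiableOn ℝ (densityDiff H h) (Ioo (-R) R) := fun x hx ↦ by
  obtain ⟨r, hxr, hrR⟩ := exists_between (abs_lt.2 hx)
  have hholder := hasHolderDerivOn_densityDiff_Icc (α := 0) hH hH1 (by simpa using hH1.le)
    ((abs_nonneg x).trans_lt hxr) hrR hR hh hh'
  refine (hholder.differentiableAt ?_).differentiableWithinAt
  rw [interior_Icc]
  exact abs_lt.1 hxr

theorem exists_holderOnWith_deriv_densityDiff {α : ℝ≥0} {r R : ℝ} (hH : 1 / 2 ≤ H) (hH1 : H < 1)
    (hα : (α : ℝ) ≤ 2 - 2 * H) (hr : 0 < r) (hrR : r < R) (hR : R ≤ 1)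
    (hh : ContDiffOn ℝ 2 h (Ioo (-R) R)) (hh' : deriv h 0 = 0) :
    ∃ C : ℝ≥0, HolderOnWith C α (deriv (densityDiff H h)) (Icc (-r) r) := by
  obtain ⟨q, hrq, hqR⟩ := exists_between hrR
  refine (hasHolderDerivOn_densityDiff_Icc hH hH1 hα (hr.trans hrq) hqR hR hh hh')
    |>.exists_holderOnWith_deriv ?_
  rw [interior_Icc]
  exact Icc_subset_Ioo (neg_lt_neg hrq) hrq

end SpectralDensities

end FracNoise

open FracNoise in
theorem mainTheorem5_general (H V : ℝ) (hH : 1 / 2 ≤ H) (hH1 : H < 1) (h : ℝ → ℝ)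
    (hC2 : ContDiffOn ℝ 2 h (Ioo (-1 / 2 : ℝ) (1 / 2))) (hh' : deriv h 0 = 0)
    (hnorm : fracPrefactor H h = fgnPrefactor H V) :
    ∃ φ : ℝ → ℝ,
      (∀ x ∈ Icc (-1 / 2 : ℝ) (1 / 2), x ≠ 0 → fracDensity H h x = fgnDensity H V x + φ x) ∧
      φ 0 = 0 ∧
      φ =O[𝓝 0] (fun x : ℝ ↦ |x| ^ (3 - 2 * H)) ∧
      DifferentiableOn ℝ φ (Ioo (-1 / 2 : ℝ) (1 / 2)) ∧
      (∀ α : ℝ≥0, (α : ℝ) ≤ 2 - 2 * H → ∀ r : ℝ, 0 < r → r < 1 / 2 →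
        ∃ C : ℝ≥0, HolderOnWith C α (deriv φ) (Icc (-r) r)) ∧
      (ContDiffOn ℝ 2 h (Icc (-1 / 2 : ℝ) (1 / 2)) →
        DifferentiableOn ℝ φ (Icc (-1 / 2 : ℝ) (1 / 2)) ∧
        ∀ α : ℝ≥0, (α : ℝ) ≤ 2 - 2 * H →
          ∃ C : ℝ≥0, HolderOnWith C α (derivWithin φ (Icc (-1 / 2 : ℝ) (1 / 2)))
            (Icc (-1 / 2 : ℝ) (1 / 2))) := by
  have hunit : Icc (-1 / 2 : ℝ) (1 / 2) ⊆ Ioo (-1) 1 := Icc_subset_Ioo (by norm_num) (by norm_num)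
  have hsymm : ContDiffOn ℝ 2 h (Ioo (-(1 / 2)) (1 / 2)) := by rwa [← neg_div]
  have hO : densityDiff H h =O[𝓝 0] fun x ↦ |x| ^ (3 - 2 * H) :=
    isBigO_densityDiff hH hH1 (convex_Icc (-1 / 4) (1 / 4)) isCompact_Icc
      (Icc_mem_nhds (by norm_num) (by norm_num)) (Icc_subset_Ioo (by norm_num) (by norm_num))
      (hC2.mono (Icc_subset_Ioo (by norm_num) (by norm_num))) hh'
  have hdiff : DifferentiableOn ℝ (densityDiff H h) (Ioo (-1 / 2) (1 / 2)) := by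
    simpa only [neg_div] using differentiableOn_densityDiff_Ioo hH hH1 (by norm_num) hsymm hh'
  have hclosed : ContDiffOn ℝ 2 h (Icc (-1 / 2) (1 / 2)) → ∀ {α : ℝ≥0}, (α : ℝ) ≤ 2 - 2 * H →
      HasHolderDerivOn α (densityDiff H h) (Icc (-1 / 2) (1 / 2)) := fun hcl _ hα ↦
    hasHolderDerivOn_densityDiff hH hH1 hα (convex_Icc _ _) isCompact_Icc
      (Icc_mem_nhds (by norm_num) (by norm_num)) hunit hcl hh'
  exact ⟨densityDiff H h, fun x hx ↦
    fracDensity_eq_fgnDensity_add_densityDiff (by linarith) hnorm (hunit hx),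
    densityDiff_zero H h, hO, hdiff, fun α hα r hr hr' ↦
    exists_holderOnWith_deriv_densityDiff hH hH1 hα hr hr' (by norm_num) hsymm hh', fun hcl ↦
    ⟨(hclosed hcl (α := 0) (by simpa using hH1.le)).1, fun α hα ↦ (hclosed hcl hα).2⟩⟩

theorem mainTheorem5 (H V : ℝ) (hH : 1 / 2 < H) (hH1 : H < 1) (hV : 0 < V)
    (h : ℝ → ℝ)
    (hpos : ∀ x ∈ Icc (-1 / 2 : ℝ) (1 / 2), 0 < h x)
    (heven : ∀ x ∈ Icc (-1 / 2 : ℝ) (1 / 2), h (-x) = h x)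
    (hcont : ContinuousOn h (Icc (-1 / 2 : ℝ) (1 / 2)))
    (hC3 : ContDiffOn ℝ 3 h (Ioo (-1 / 2 : ℝ) (1 / 2)))
    (hnorm : FracNoise.fracPrefactor H h = FracNoise.fgnPrefactor H V) :
    ∃ φ : ℝ → ℝ,
      (∀ x ∈ Icc (-1 / 2 : ℝ) (1 / 2), x ≠ 0 →
        FracNoise.fracDensity H h x = FracNoise.fgnDensity H V x + φ x) ∧
      φ 0 = 0 ∧
      φ =O[𝓝 0] (fun x : ℝ => |x| ^ (3 - 2 * H)) ∧
      DifferentiableOn ℝ φ (Ioo (-1 / 2 : ℝ) (1 / 2)) ∧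
      (∀ α : ℝ≥0, (α : ℝ) < 2 - 2 * H → ∀ r : ℝ, 0 < r → r < 1 / 2 →
        ∃ C : ℝ≥0, HolderOnWith C α (deriv φ) (Icc (-r) r)) ∧
      (ContDiffOn ℝ 3 h (Icc (-1 / 2 : ℝ) (1 / 2)) →
        DifferentiableOn ℝ φ (Icc (-1 / 2 : ℝ) (1 / 2)) ∧
        ∀ α : ℝ≥0, (α : ℝ) < 2 - 2 * H →
          ∃ C : ℝ≥0, HolderOnWith C α (derivWithin φ (Icc (-1 / 2 : ℝ) (1 / 2)))
            (Icc (-1 / 2 : ℝ) (1 / 2))) := by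
  obtain ⟨φ, heq, hφ0, hO, hdiff, hHolder, hclosed⟩ :=
    mainTheorem5_general H V hH.le hH1 h (hC3.of_le (by norm_num))
      (FracNoise.deriv_zero_of_eventually_even <| by
        filter_upwards [Icc_mem_nhds (a := (-1 / 2 : ℝ)) (b := 1 / 2) (by norm_num) (by norm_num)]
          using heven) hnorm
  exact ⟨φ, heq, hφ0, hO, hdiff, fun α hα ↦ hHolder α hα.le, fun hcl ↦
    (hclosed (hcl.of_le (by norm_num))).imp_right fun hα_closed α hα ↦ hα_closed α hα.le⟩
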